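/- Let $R$ be a commutative Noetherian ring of finite Krull dimension and let $M$ be a finitely generated $R$-module. Definitions. Write ordinals in Cantor normal form $\alpha=\sum_i a_i\omega^i$ with $a_i\in\mathbb N$. The valence of $\alpha$ is $\sum_i a_i$, and the shuffle (natural) sum $\alpha\oplus\beta$ is obtained by adding the coefficients of the Cantor normal forms. The length $\operatorname{len}(M)$ is the supremum of the ordinals that are order types of chains of non-zero submodules of $M$, ordered by inverse inclusion (for a module of finite length this is the usual length), and the valence of $M$ is the valence of the ordinal $\operatorname{len}(M)$. The finitistic length $\ell(M)$ is the supremum of all $\operatorname{len}(N)$, for $N\subseteq M$ a submodule with $\operatorname{len}(N)<\omega$. The fundamental cycle of $M$ is the formal sum $\sum_{\mathfrak p}\ell(M_{\mathfrak p})\,[\mathfrak p]$ over the associated primes $\mathfrak p$ of $M$, with $\ell(M_{\mathfrak p})$ computed over $R_{\mathfrak p}$. The module $M$ is binary if its fundamental cycle is a sum of distinct primes $[\mathfrak p]$. Statement. Suppose $M$ is binary, of valence $v$, and let $f$ be any $R$-linear endomorphism of $M$. Then $\ker(f^{v})=\ker(f^{v+1})$. Moreover, $f^v$ is reductive, that is,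 $\ker(f^v)\cap f^v(M)=0$, and $f^v$ satisfies the rank-nullity equality $$\operatorname{len}(M)=\operatorname{len}(\ker(f^v))\oplus\operatorname{len}(f^v(M)).$$ -/

import Mathlib

open scoped Ordinal

universe u v

noncomputable section

namespace OrdLen

/-- The shuffle (natural) sum of two ordinals: add the coefficients of the Cantor normal forms.
(All coefficients in base `ω` are finite, so the sum of coefficients is the sum in `ℕ`.) -/
def shuffleSum (α β : Ordinal.{u}) : Ordinal.{u} :=
  Ordinal.CNF.eval ω (Ordinal.CNF.coeff ω α + Ordinal.CNF.coeff ω β)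

/-- The natural number equal to a finite ordinal (and `0` for an infinite ordinal). -/
def finiteValue (α : Ordinal.{u}) : ℕ :=
  Cardinal.toNat α.card

/-- The valence of an ordinal: the sum of all the (finite) coefficients in its Cantor normal
form. -/
def valence (α : Ordinal.{u}) : ℕ :=
  (Ordinal.CNF.coeff ω α).sum fun _ c => finiteValue c

section Modules

variable (R : Type u) [CommRing R] (M : Type v) [AddCommGroup M] [Module R M]

/-- The ordinals that arise as a chain of submodules of `M` ordered by inverse inclusion, that is,
the `α` for which there is a strictly descending `α`-indexed sequence of submodules. As usual for
the length of a module, one counts steps: the final submodule `0` is not counted, so the members of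
the chain are non-zero submodules. -/
def chainOrdinals : Set Ordinal.{v} :=
  {α | ∃ c : Set.Iio α → Submodule R M, StrictAnti c ∧ ∀ i, c i ≠ ⊥}

/-- The (ordinal) length of a module: the supremum of all ordinals arising as chains of submodules
ordered by inverse inclusion. -/
def length : Ordinal.{v} :=
  sSup (chainOrdinals R M)

/-- The set of ordinals arising as chains is bounded, so that `length` is a genuine supremum. -/
theorem bddAbove_chainOrdinals : BddAbove (chainOrdinals R M) := by
  refine ⟨(Order.succ (Cardinal.mk (Submodule R M))).ord, ?_⟩
  rintro α ⟨c, hc, -⟩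
  have h := Cardinal.mk_le_of_injective
    (f := fun i : Set.Iio α => ULift.up.{v + 1} (c i)) (by
      intro i j hij
      exact hc.injective (ULift.up.inj hij))
  rw [Cardinal.mk_uLift, Cardinal.mk_Iio_ordinal, Cardinal.lift_le] at h
  exact (Cardinal.lt_ord.2 (Order.lt_succ_of_le h)).le

/-- The finitistic length of a module: the supremum of the lengths of all its submodules of finite
length. -/
def finitisticLength : Ordinal.{v} :=
  sSup {α | ∃ N : Submodule R M, length R N = α ∧ α < ω}

/-- The multiplicity of the prime `p` in the fundamental cycle of `M`: the finitistic length of the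
`R_p`-module `M_p` (a natural number if `M` is a Noetherian module). -/
def multiplicity (p : PrimeSpectrum R) : ℕ :=
  finiteValue (finitisticLength (Localization.AtPrime p.asIdeal)
    (LocalizedModule p.asIdeal.primeCompl M))

/-- The associated primes of `M`, as a set of points of the spectrum. -/
def assPoints : Set (PrimeSpectrum R) :=
  {p | p.asIdeal ∈ associatedPrimes R M}

/-- A finitely generated module over a Noetherian ring has finitely many associated primes. -/
theorem finite_assPoints [IsNoetherianRing R] [Module.Finite R M] : (assPoints R M).Finite :=
  (associatedPrimes.finite R M).preimage (fun _ _ _ _ h => PrimeSpectrum.ext h)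

/-- The fundamental cycle of `M`: the element of the free abelian group on the primes of `R` given
by the formal sum over the associated primes `p` of `M` of the finitistic length of `M_p`
times `[p]`. -/
def fundamentalCycle : PrimeSpectrum R →₀ ℤ :=
  ∑ᶠ p ∈ assPoints R M, Finsupp.single p (multiplicity R M p : ℤ)

/-- A module is binary if its fundamental cycle is a sum of distinct primes. -/
def IsBinary : Prop :=
  ∃ S : Finset (PrimeSpectrum R), fundamentalCycle R M = ∑ p ∈ S, Finsupp.single p (1 : ℤ)

variable {R M}

/-- An endomorphism is reductive if its kernel and its image intersect in zero. -/
def IsReductive (f : Module.End R M) : Prop :=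
  LinearMap.ker f ⊓ LinearMap.range f = ⊥

/-- The rank-nullity equality: the length of the module is the shuffle sum of the lengths of the
kernel and the image. -/
def RankNullity (f : Module.End R M) : Prop :=
  length R M = shuffleSum (length R (LinearMap.ker f)) (length R (LinearMap.range f))

end Modules

end OrdLen

end

noncomputable section

namespace OrdLen

open Ordinal

/-! ### Shuffle sums -/

/-! Binarity is used only through `HasSimpleLocalTorsion`: near an associated prime `p`, the locally
torsion elements form a module of rank one. If `p` is minimal among the associated primes, let `L`
be the kernel of `M → M_p`. Then `L` has exactly the other associated primes, and `M ⧸ L` has rank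
one over `R ⧸ p`. This allows induction on the number of associated primes.

For lengths, choose `p` of maximal dimension `d`. Then `len(M ⧸ L) = ω ^ d`, and the bounds `ω ^ d +
len L ≤ len M ≤ ω ^ d ⊕ len L` coincide. Hence the coefficients of `len M` count associated primes
by dimension (`coeff_length`), and the valence is their number.

For a nilpotent `f`, rank one forces `f` to vanish at `p`, so `f` maps `M` into `L`. By induction
the power of `f` given by the number of associated primes is zero (`pow_ncard_assPoints_eq_zero`).
Applied to `f` on each `ker (f ^ m)`, this stabilises the kernels at the valence, so kernel and
image of that power are disjoint. Their associated primes then partition those of `M`, and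
rank-nullity follows by counting. -/

theorem coeff_omega0_lt (o e : Ordinal.{u}) : CNF.coeff ω o e < ω := by
  by_cases h : e ∈ (CNF ω o).map Prod.fst
  · obtain ⟨⟨e', c⟩, hc, rfl⟩ := List.mem_map.1 h
    rw [CNF.coeff_of_mem_CNF hc]
    exact CNF.snd_lt one_lt_omega0 hc
  · rw [CNF.coeff_of_notMem_CNF h]
    exact omega0_pos

theorem eval_filter_le_add (f : Ordinal.{u} →₀ Ordinal.{u}) (e : Ordinal.{u}) :
    CNF.eval ω f = CNF.eval ω (f.filter (e < ·)) + CNF.eval ω (f.filter fun a => ¬ e < a) := by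
  rw [← CNF.eval_add]
  · congr 1
    ext a
    rw [Finsupp.add_apply]
    by_cases h : e < a
    · simp [h]
    · simp [Finsupp.filter_apply, h]
  · intro a ha b hb
    rw [Finsupp.support_filter, Finset.mem_filter] at ha hb
    exact (not_lt.1 hb.2).trans ha.2.le

theorem eval_filter_not_lt (f : Ordinal.{u} →₀ Ordinal.{u}) (e : Ordinal.{u}) :
    CNF.eval ω (f.filter fun a => ¬ e < a) = ω ^ e * f e + CNF.eval ω (f.filter (· < e)) := by
  rw [← CNF.eval_single_add']
  · congr 1
    ext a
    rw [Finsupp.add_apply]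
    rcases lt_trichotomy a e with h | rfl | h
    · simp [h, h.le, h.ne]
    · simp
    · simp [h, h.not_gt, h.ne']
  · intro a ha
    rw [Finsupp.support_filter, Finset.mem_filter] at ha
    exact ha.2

/-- Terms above `e` cancel, and the part of `f` below `e` is less than `ω ^ e`, so it cannot make up
for the deficit at `e`. -/
theorem eval_lt_eval {f g : Ordinal.{u} →₀ Ordinal.{u}} (hf : ∀ e, f e < ω) {e : Ordinal.{u}}
    (he : f e < g e) (h : ∀ e', e < e' → f e' = g e') : CNF.eval ω f < CNF.eval ω g := by
  rw [eval_filter_le_add f e, eval_filter_le_add g e, eval_filter_not_lt, eval_filter_not_lt]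
  have h1 : f.filter (e < ·) = g.filter (e < ·) := by
    ext a
    by_cases ha : e < a
    · simp [ha, h a ha]
    · simp [ha]
  rw [h1, add_lt_add_iff_left]
  have h2 : CNF.eval ω (f.filter (· < e)) < ω ^ e := by
    apply CNF.eval_lt
    · intro a
      by_cases ha : a < e
      · simpa [ha] using hf a
      · simp [ha]
    · intro a ha
      rw [Finsupp.support_filter, Finset.mem_filter] at ha
      exact ha.2
  calc ω ^ e * f e + CNF.eval ω (f.filter (· < e)) < ω ^ e * f e + ω ^ e := by
        rwa [add_lt_add_iff_left]
    _ = ω ^ e * Order.succ (f e) := by rw [mul_succ]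
    _ ≤ ω ^ e * g e := mul_le_mul_right (Order.succ_le_of_lt he) _
    _ ≤ _ := le_self_add

theorem exists_coeff_lt_of_lt {α β : Ordinal.{u}} (h : α < β) :
    ∃ e, CNF.coeff ω α e < CNF.coeff ω β e ∧
      ∀ e', e < e' → CNF.coeff ω α e' = CNF.coeff ω β e' := by
  classical
  set f := CNF.coeff ω α
  set g := CNF.coeff ω β
  let s := (f.support ∪ g.support).filter fun e => f e ≠ g e
  have hs (e) : e ∈ s ↔ f e ≠ g e := by
    simp only [s, Finset.mem_filter, Finset.mem_union, Finsupp.mem_support_iff,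
      and_iff_right_iff_imp]
    intro hne
    by_contra! h0
    exact hne (h0.1.trans h0.2.symm)
  have hne : s.Nonempty := by
    by_contra! h0
    refine h.ne (CNF.coeff_injective ω (Finsupp.ext fun e => ?_))
    by_contra he
    have := (hs e).2 he
    simp [h0] at this
  have hmax (e') (he' : s.max' hne < e') : f e' = g e' := by
    by_contra h0
    exact (s.le_max' _ ((hs e').2 h0)).not_gt he'
  refine ⟨s.max' hne, ?_, hmax⟩
  refine lt_of_le_of_ne (le_of_not_gt fun hlt => ?_) ((hs _).1 (s.max'_mem hne))
  have := eval_lt_eval (coeff_omega0_lt β) hlt fun e' he' => (hmax e' he').symm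
  rw [CNF.eval_coeff, CNF.eval_coeff] at this
  exact this.not_gt h

theorem coeff_add_coeff_lt (α β e : Ordinal.{u}) : (CNF.coeff ω α + CNF.coeff ω β) e < ω :=
  isPrincipal_add_omega0 (coeff_omega0_lt α e) (coeff_omega0_lt β e)

theorem coeff_shuffleSum (α β : Ordinal.{u}) :
    CNF.coeff ω (shuffleSum α β) = CNF.coeff ω α + CNF.coeff ω β :=
  CNF.coeff_eval one_lt_omega0 (coeff_add_coeff_lt α β)

/-- Ordinal addition is not commutative; finiteness of the coefficients is what saves it here. -/
theorem coeff_add_coeff_comm (α β : Ordinal.{u}) :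
    CNF.coeff ω α + CNF.coeff ω β = CNF.coeff ω β + CNF.coeff ω α := by
  ext e
  obtain ⟨m, hm⟩ := lt_omega0.1 (coeff_omega0_lt α e)
  obtain ⟨n, hn⟩ := lt_omega0.1 (coeff_omega0_lt β e)
  rw [Finsupp.add_apply, Finsupp.add_apply, hm, hn, ← Nat.cast_add, add_comm, Nat.cast_add]

theorem shuffleSum_comm (α β : Ordinal.{u}) : shuffleSum α β = shuffleSum β α := by
  rw [shuffleSum, coeff_add_coeff_comm, shuffleSum]

theorem shuffleSum_lt_shuffleSum_right (γ : Ordinal.{u}) {α β : Ordinal.{u}} (h : α < β) :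
    shuffleSum γ α < shuffleSum γ β := by
  obtain ⟨e, he, he'⟩ := exists_coeff_lt_of_lt h
  refine eval_lt_eval (coeff_add_coeff_lt _ _) (e := e) ?_ fun e' h' => ?_
  · rw [Finsupp.add_apply, Finsupp.add_apply]
    exact (add_lt_add_iff_left _).2 he
  · rw [Finsupp.add_apply, Finsupp.add_apply, he' e' h']

theorem shuffleSum_lt_shuffleSum_left (γ : Ordinal.{u}) {α β : Ordinal.{u}} (h : α < β) :
    shuffleSum α γ < shuffleSum β γ := by
  rw [shuffleSum_comm α, shuffleSum_comm β]
  exact shuffleSum_lt_shuffleSum_right γ h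

theorem shuffleSum_le_shuffleSum {α β γ δ : Ordinal.{u}} (h : α ≤ β) (h' : γ ≤ δ) :
    shuffleSum α γ ≤ shuffleSum β δ :=
  (StrictMono.monotone (fun _ _ => shuffleSum_lt_shuffleSum_left γ) h).trans
    (StrictMono.monotone (fun _ _ => shuffleSum_lt_shuffleSum_right β) h')

theorem shuffleSum_lt_opow {α β e : Ordinal.{u}} (hα : α < ω ^ e) (hβ : β < ω ^ e) :
    shuffleSum α β < ω ^ e := by
  refine CNF.eval_lt (coeff_add_coeff_lt α β) fun e' he' => ?_
  by_contra! h
  have h1 := opow_le_opow_right omega0_pos h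
  rw [Finsupp.mem_support_iff, Finsupp.add_apply, CNF.coeff_eq_zero_of_lt (hα.trans_le h1),
    CNF.coeff_eq_zero_of_lt (hβ.trans_le h1), add_zero] at he'
  exact he' rfl

theorem coeff_omega0_opow (e : Ordinal.{u}) : CNF.coeff ω (ω ^ e) = Finsupp.single e 1 := by
  have := CNF.coeff_opow_mul_add one_lt_omega0 one_ne_zero one_lt_omega0
    (opow_pos e omega0_pos)
  simpa using this

/-- Nothing is absorbed when the leading term already stands on the left, so natural and ordinary
sums agree. -/
theorem shuffleSum_omega0_opow {e β : Ordinal.{u}}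
    (h : ∀ e' ∈ (CNF.coeff ω β).support, e' ≤ e) : shuffleSum (ω ^ e) β = ω ^ e + β := by
  rw [shuffleSum, coeff_omega0_opow, CNF.eval_single_add _ h, CNF.eval_coeff, mul_one]

/-! ### Chains of submodules -/

section Modules

variable {R : Type u} [CommRing R] {M : Type v} [AddCommGroup M] [Module R M]

theorem le_length {α : Ordinal.{v}} (h : α ∈ chainOrdinals R M) : α ≤ length R M :=
  le_csSup (bddAbove_chainOrdinals R M) h

theorem zero_mem_chainOrdinals : 0 ∈ chainOrdinals R M :=
  ⟨fun i => absurd i.2 (by simp), fun i => absurd i.2 (by simp), fun i => absurd i.2 (by simp)⟩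

theorem one_mem_chainOrdinals [Nontrivial M] : 1 ∈ chainOrdinals R M := by
  refine ⟨fun _ => ⊤, fun i j hij => ?_, fun _ => top_ne_bot⟩
  exact absurd (Subtype.ext ((Order.lt_one_iff.1 i.2).trans (Order.lt_one_iff.1 j.2).symm)) hij.ne

theorem length_le {α : Ordinal.{v}} (h : ∀ β ∈ chainOrdinals R M, β ≤ α) : length R M ≤ α :=
  csSup_le ⟨0, zero_mem_chainOrdinals⟩ h

theorem mem_chainOrdinals_of_le {α β : Ordinal.{v}} (h : β ∈ chainOrdinals R M) (hα : α ≤ β) :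
    α ∈ chainOrdinals R M := by
  obtain ⟨c, hc, hc0⟩ := h
  exact ⟨fun i => c ⟨i.1, lt_of_lt_of_le i.2 hα⟩, fun i j hij => hc hij, fun i => hc0 _⟩

variable {N : Type v} [AddCommGroup N] [Module R N]

theorem map_ne_bot {f : N →ₗ[R] M} (hf : Function.Injective f) {A : Submodule R N} (hA : A ≠ ⊥) :
    A.map f ≠ ⊥ := fun h =>
  hA (Submodule.map_injective_of_injective hf (h.trans (Submodule.map_bot f).symm))

theorem chainOrdinals_mono {f : N →ₗ[R] M} (hf : Function.Injective f) :
    chainOrdinals R N ⊆ chainOrdinals R M := by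
  rintro α ⟨c, hc, hc0⟩
  refine ⟨fun i => (c i).map f, fun i j hij => Submodule.map_strictMono_of_injective hf (hc hij),
    fun i => map_ne_bot hf (hc0 i)⟩

theorem length_mono {f : N →ₗ[R] M} (hf : Function.Injective f) : length R N ≤ length R M :=
  length_le fun _ h => le_length (chainOrdinals_mono hf h)

theorem length_congr (e : N ≃ₗ[R] M) : length R N = length R M :=
  (length_mono (f := e.toLinearMap) e.injective).antisymm
    (length_mono (f := e.symm.toLinearMap) e.symm.injective)

theorem length_eq_zero_of_subsingleton [Subsingleton M] : length R M = 0 := by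
  refine le_antisymm (length_le fun α ⟨c, _, hc⟩ => ?_) (zero_le)
  by_contra! h
  exact hc ⟨0, h⟩ (Subsingleton.elim _ _)

/-- Cutting off a chain at index `i` gives a chain in the quotient by its `i`-th member. -/
theorem mem_chainOrdinals_quotient {α : Ordinal.{v}} {c : Set.Iio α → Submodule R M}
    (hc : StrictAnti c) (i : Set.Iio α) : i.1 ∈ chainOrdinals R (M ⧸ c i) := by
  let e (j : Set.Iio i.1) : Set.Iio α := ⟨j.1, lt_trans (Set.mem_Iio.1 j.2) i.2⟩
  have hlt (j : Set.Iio i.1) : c i < c (e j) := hc j.2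
  have hcomap (j : Set.Iio i.1) : ((c (e j)).map (c i).mkQ).comap (c i).mkQ = c (e j) := by
    rw [Submodule.comap_map_mkQ, sup_eq_right]
    exact (hlt j).le
  refine ⟨fun j => (c (e j)).map (c i).mkQ, fun j k hjk => ?_, fun j hj => ?_⟩
  · refine lt_of_le_of_ne (Submodule.map_mono (hc hjk).le) fun h => ?_
    have h' := congrArg (Submodule.comap (c i).mkQ) h
    rw [hcomap, hcomap] at h'
    exact (hc (show e j < e k from hjk)).ne h'
  · have h' := congrArg (Submodule.comap (c i).mkQ) hj
    rw [hcomap, Submodule.comap_bot, Submodule.ker_mkQ] at h'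
    exact (hlt j).ne' h'

theorem lt_comap_mkQ (L : Submodule R M) {A : Submodule R (M ⧸ L)} (hA : A ≠ ⊥) :
    L < A.comap L.mkQ := by
  refine lt_of_le_of_ne (fun x hx => ?_) fun h => hA ?_
  · rw [Submodule.mem_comap, Submodule.mkQ_apply, (Submodule.Quotient.mk_eq_zero L).2 hx]
    exact zero_mem _
  · rw [← Submodule.map_comap_eq_of_surjective L.mkQ_surjective A, ← h, Submodule.mkQ_map_self]

/-- A chain of a quotient followed by a chain of the submodule. -/
theorem add_mem_chainOrdinals (L : Submodule R M) {α β : Ordinal.{v}}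
    (hα : α ∈ chainOrdinals R (M ⧸ L)) (hβ : β ∈ chainOrdinals R L) :
    α + β ∈ chainOrdinals R M := by
  classical
  obtain ⟨c, hc, hc0⟩ := hα
  obtain ⟨d, hd, hd0⟩ := hβ
  have hsub {i : Ordinal.{v}} (hi : i < α + β) (h : ¬ i < α) : i - α < β := by
    rw [← add_lt_add_iff_left α, Ordinal.add_sub_cancel_of_le (not_lt.1 h)]
    exact hi
  refine ⟨fun i => if h : i.1 < α then (c ⟨i.1, h⟩).comap L.mkQ
    else (d ⟨i.1 - α, hsub i.2 h⟩).map L.subtype, fun i j hij => ?_, fun i => ?_⟩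
  · have hij' : i.1 < j.1 := hij
    by_cases hj : j.1 < α
    · simp only [hj, hij'.trans hj, dif_pos]
      have h1 : c ⟨j.1, hj⟩ < c ⟨i.1, hij'.trans hj⟩ := hc hij'
      exact Submodule.comap_strictMono_of_surjective L.mkQ_surjective h1
    · by_cases hi : i.1 < α
      · simp only [hi, hj, dif_pos, dif_neg, not_false_eq_true]
        exact (Submodule.map_subtype_le _ _).trans_lt (lt_comap_mkQ L (hc0 _))
      · simp only [hi, hj, dif_neg, not_false_eq_true]
        refine Submodule.map_strictMono_of_injective L.injective_subtype (hd ?_)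
        change i.1 - α < j.1 - α
        rw [← add_lt_add_iff_left α, Ordinal.add_sub_cancel_of_le (not_lt.1 hi),
          Ordinal.add_sub_cancel_of_le (not_lt.1 hj)]
        exact hij'
  · by_cases hi : i.1 < α
    · simp only [hi, dif_pos]
      exact (bot_le.trans_lt (lt_comap_mkQ L (hc0 _))).ne'
    · simp only [hi, dif_neg, not_false_eq_true]
      exact map_ne_bot L.injective_subtype (hd0 _)

/-- Addition is continuous on the right, so the length of `L` need not be attained. It is not
continuous on the left, so `α` must be an actual chain. -/
theorem add_length_le (L : Submodule R M) {α : Ordinal.{v}} (hα : α ∈ chainOrdinals R (M ⧸ L)) :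
    α + length R L ≤ length R M := by
  rw [length, (isNormal_add_right α).map_sSup ⟨0, zero_mem_chainOrdinals⟩
    (bddAbove_chainOrdinals R L)]
  refine csSup_le ⟨_, Set.mem_image_of_mem _ zero_mem_chainOrdinals⟩ ?_
  rintro _ ⟨β, hβ, rfl⟩
  exact le_length (add_mem_chainOrdinals L hα hβ)

/-- The rank of a submodule with respect to the members of a set `S` that strictly contain it. -/
def rankIn [IsNoetherian R M] (S : Set (Submodule R M)) : Submodule R M → Ordinal.{v} :=
  IsWellFounded.rank (hwf := ⟨Subrelation.wf (h₂ := wellFounded_gt) (fun h => h.2)⟩)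
    (fun A B => A ∈ S ∧ A > B)

section Rank

variable [IsNoetherian R M] {S : Set (Submodule R M)}

theorem rankIn_lt {A B : Submodule R M} (hA : A ∈ S) (h : B < A) : rankIn S A < rankIn S B :=
  have : IsWellFounded (Submodule R M) (fun A B => A ∈ S ∧ A > B) :=
    ⟨Subrelation.wf (h₂ := wellFounded_gt) (fun h => h.2)⟩
  IsWellFounded.rank_lt_of_rel (r := fun A B => A ∈ S ∧ A > B) ⟨hA, h⟩

theorem exists_rankIn_eq {α : Ordinal.{v}} {B : Submodule R M} (h : α < rankIn S B) :
    ∃ A ∈ S, B < A ∧ rankIn S A = α := by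
  have : IsWellFounded (Submodule R M) (fun A B => A ∈ S ∧ A > B) :=
    ⟨Subrelation.wf (h₂ := wellFounded_gt) (fun h => h.2)⟩
  induction B using WellFoundedGT.induction with
  | ind B ih =>
    have h' := h
    rw [rankIn, IsWellFounded.rank_eq, Ordinal.lt_iSup_iff] at h'
    obtain ⟨⟨A, hA⟩, hlt⟩ := h'
    rcases (Order.lt_succ_iff.1 hlt).eq_or_lt with h0 | h0
    · exact ⟨A, hA.1, hA.2, h0.symm⟩
    · obtain ⟨C, hC, hAC, rfl⟩ := ih A hA.2 h0
      exact ⟨C, hC, hA.2.trans hAC, rfl⟩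

/-- Members of a chain are comparable and smaller ones have larger rank, so choosing one member of
each rank gives a descending sequence. -/
theorem mem_chainOrdinals_of_exists_rankIn (hS : IsChain (· ≤ ·) S) {γ : Ordinal.{v}}
    (h : ∀ α < γ, ∃ A ∈ S, A ≠ ⊥ ∧ rankIn S A = α) : γ ∈ chainOrdinals R M := by
  choose! c hcS hc0 hc using h
  refine ⟨fun i => c i, fun i j hij => ?_, fun i => hc0 i i.2⟩
  have hij' : i.1 < j.1 := hij
  by_contra hlt
  rcases hS.total (hcS i i.2) (hcS j j.2) with h | h
  · rcases h.eq_or_lt with h | h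
    · rw [← hc i i.2, ← hc j j.2, h] at hij'
      exact hij'.false
    · have := rankIn_lt (hcS j j.2) h
      rw [hc i i.2, hc j j.2] at this
      exact this.not_gt hij'
  · rcases h.eq_or_lt with h | h
    · rw [← hc i i.2, ← hc j j.2, h] at hij'
      exact hij'.false
    · exact hlt h

theorem rankIn_le_length (hS : IsChain (· ≤ ·) S) (B : Submodule R M) :
    rankIn S B ≤ length R M := by
  refine le_length (mem_chainOrdinals_of_exists_rankIn hS fun α hα => ?_)
  obtain ⟨A, hA, hBA, h⟩ := exists_rankIn_eq hα
  exact ⟨A, hA, (bot_le.trans_lt hBA).ne', h⟩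

theorem rankIn_lt_length (hS : IsChain (· ≤ ·) S) {B : Submodule R M} (hB : B ∈ S)
    (hB0 : B ≠ ⊥) : rankIn S B < length R M := by
  rw [← Order.succ_le_iff]
  refine le_length (mem_chainOrdinals_of_exists_rankIn hS fun α hα => ?_)
  rcases (Order.lt_succ_iff.1 hα).eq_or_lt with rfl | hα
  · exact ⟨B, hB, hB0, rfl⟩
  · obtain ⟨A, hA, hBA, h⟩ := exists_rankIn_eq hα
    exact ⟨A, hA, (bot_le.trans_lt hBA).ne', h⟩

end Rank

theorem le_of_strictMono_Iio {γ : Ordinal.{v}} {f : Set.Iio γ → Ordinal.{v}} (hf : StrictMono f)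
    (i : Set.Iio γ) : i.1 ≤ f i := by
  induction i using WellFoundedLT.induction with
  | ind i ih =>
    by_contra! h
    have h1 : (⟨f i, h.trans i.2⟩ : Set.Iio γ) < i := h
    exact (ih _ h1).not_gt (hf h1)

/-- Along a chain, the images in `M ⧸ L` and the traces on `L` descend weakly, and one of them drops
at each step. The natural sum of their ranks is thus a strictly increasing function of the index,
hence at least the index. -/
theorem length_le_shuffleSum [IsNoetherian R M] (L : Submodule R M) :
    length R M ≤ shuffleSum (length R (M ⧸ L)) (length R L) := by
  refine length_le ?_
  rintro γ ⟨c, hc, hc0⟩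
  let q (i) := (c i).map L.mkQ
  let l (i) := (c i).comap L.subtype
  have hq : Antitone q := fun i j h => Submodule.map_mono (hc.antitone h)
  have hl : Antitone l := fun i j h => Submodule.comap_mono (hc.antitone h)
  have hqS : IsChain (· ≤ ·) (Set.range q) := hq.isChain_range
  have hlS : IsChain (· ≤ ·) (Set.range l) := hl.isChain_range
  -- The modular law: nested submodules with the same trace on `L` and the same image modulo `L` are
  -- equal.
  have key (A B : Submodule R M) (hAB : A ≤ B) (h1 : A.map L.mkQ = B.map L.mkQ)
      (h2 : A.comap L.subtype = B.comap L.subtype) : A = B := by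
    refine eq_of_le_of_inf_le_of_sup_le hAB (z := L) ?_ ?_
    · have := congrArg (Submodule.map L.subtype) h2
      rw [Submodule.map_comap_subtype, Submodule.map_comap_subtype] at this
      rw [inf_comm A, inf_comm B, this]
    · have := congrArg (Submodule.comap L.mkQ) h1
      rw [Submodule.comap_map_mkQ, Submodule.comap_map_mkQ] at this
      rw [sup_comm A, sup_comm B, this]
  have hmono : StrictMono fun i =>
      shuffleSum (rankIn (Set.range q) (q i)) (rankIn (Set.range l) (l i)) := by
    intro i j hij
    dsimp only
    rcases (hq hij.le).eq_or_lt with h1 | h1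
    · rcases (hl hij.le).eq_or_lt with h2 | h2
      · exact absurd (key _ _ (hc hij).le h1 h2) (hc hij).ne
      · rw [h1]
        exact shuffleSum_lt_shuffleSum_right _ (rankIn_lt (Set.mem_range_self i) h2)
    · refine (shuffleSum_lt_shuffleSum_left _ (rankIn_lt (Set.mem_range_self i) h1)).trans_le
        (shuffleSum_le_shuffleSum le_rfl ?_)
      rcases (hl hij.le).eq_or_lt with h2 | h2
      · rw [h2]
      · exact (rankIn_lt (Set.mem_range_self i) h2).le
  refine le_of_forall_lt fun i hi => ?_
  refine (le_of_strictMono_Iio hmono ⟨i, hi⟩ :).trans_lt ?_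
  -- A non-zero member has non-zero image or non-zero trace; that one has rank strictly below the
  -- corresponding length.
  by_cases h0 : l ⟨i, hi⟩ = ⊥
  · have h1 : q ⟨i, hi⟩ ≠ ⊥ := by
      intro h1
      refine hc0 ⟨i, hi⟩ (key _ _ bot_le ?_ ?_).symm
      · rw [Submodule.map_bot]; exact h1.symm
      · rw [Submodule.comap_bot, Submodule.ker_subtype]; exact h0.symm
    exact (shuffleSum_lt_shuffleSum_left _ (rankIn_lt_length hqS (Set.mem_range_self _) h1)).trans_le
      (shuffleSum_le_shuffleSum le_rfl (rankIn_le_length hlS _))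
  · exact (shuffleSum_lt_shuffleSum_right _ (rankIn_lt_length hlS (Set.mem_range_self _) h0)).trans_le
      (shuffleSum_le_shuffleSum (rankIn_le_length hqS _) le_rfl)

/-! ### The length of a quotient by a prime ideal -/

theorem length_lt_opow_of_exact {N₁ N₂ N₃ : Type v} [AddCommGroup N₁] [Module R N₁]
    [AddCommGroup N₂] [Module R N₂] [AddCommGroup N₃] [Module R N₃] [IsNoetherian R N₂]
    {f : N₁ →ₗ[R] N₂} {g : N₂ →ₗ[R] N₃} (hf : Function.Injective f) (hg : Function.Surjective g)
    (hfg : Function.Exact f g) {e : Ordinal.{v}} (h₁ : length R N₁ < ω ^ e)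
    (h₃ : length R N₃ < ω ^ e) : length R N₂ < ω ^ e := by
  refine (length_le_shuffleSum (LinearMap.range f)).trans_lt (shuffleSum_lt_opow ?_ ?_)
  · rwa [length_congr ((Submodule.quotEquivOfEq _ _ hfg.linearMap_ker_eq.symm).trans
      (g.quotKerEquivOfSurjective hg))]
  · rwa [← length_congr (LinearEquiv.ofInjective f hf)]

/-- Dévissage into quotients by primes: annihilators only grow in submodules and quotients, and
ordinals below `ω ^ e` are closed under natural sums. The copies `D` keep all lengths in the
universe of the modules. -/
theorem length_lt_opow_of_lt_annihilator [IsNoetherianRing R] {e : Ordinal.{v}} (I : Ideal R)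
    (IH : ∀ q : PrimeSpectrum R, I < q.asIdeal → ∀ (D : Type v) [AddCommGroup D] [Module R D],
      (D ≃ₗ[R] R ⧸ q.asIdeal) → length R D < ω ^ e)
    (Q : Type v) [AddCommGroup Q] [Module R Q] [hQ : Module.Finite R Q]
    (h : I < Module.annihilator R Q) : length R Q < ω ^ e := by
  revert h
  induction hQ using IsNoetherianRing.induction_on_isQuotientEquivQuotientPrime R with
  | subsingleton N =>
    intro _
    rw [length_eq_zero_of_subsingleton]
    exact opow_pos e omega0_pos
  | quotient N q f =>
    intro h
    rw [f.annihilator_eq, Ideal.annihilator_quotient] at h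
    exact IH q h N f
  | exact N₁ N₂ N₃ f g hf hg hfg h₁ h₃ =>
    intro h
    exact length_lt_opow_of_exact hf hg hfg (h₁ (h.trans_le (f.annihilator_le_of_injective hf)))
      (h₃ (h.trans_le (g.annihilator_le_of_surjective hg)))

section QuotientPrime

variable {p : PrimeSpectrum R} {D : Type v} [AddCommGroup D] [Module R D]

theorem smul_eq_zero_of_quotientPrime (f : D ≃ₗ[R] R ⧸ p.asIdeal) {a : R} (ha : a ∉ p.asIdeal)
    {x : D} (h : a • x = 0) : x = 0 := by
  have h' := congrArg f h
  rw [map_smul, map_zero, Algebra.smul_def, mul_eq_zero] at h'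
  rcases h' with h' | h'
  · exact absurd (Ideal.Quotient.eq_zero_iff_mem.1 h') ha
  · exact (LinearEquiv.map_eq_zero_iff f).1 h'

theorem lt_annihilator_quotient (f : D ≃ₗ[R] R ⧸ p.asIdeal) {A : Submodule R D} (hA : A ≠ ⊥) :
    p.asIdeal < Module.annihilator R (D ⧸ A) := by
  obtain ⟨y, hy, hy0⟩ := A.exists_mem_ne_zero_of_ne_bot hA
  obtain ⟨a, ha⟩ := Ideal.Quotient.mk_surjective (f y)
  refine SetLike.lt_iff_le_and_exists.2 ⟨?_, a, ?_, fun hap => hy0 ?_⟩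
  · refine le_trans ?_ (A.mkQ.annihilator_le_of_surjective A.mkQ_surjective)
    rw [f.annihilator_eq, Ideal.annihilator_quotient]
  · rw [Module.mem_annihilator]
    intro z
    obtain ⟨z, rfl⟩ := A.mkQ_surjective z
    obtain ⟨b, hb⟩ := Ideal.Quotient.mk_surjective (f z)
    rw [← map_smul, Submodule.mkQ_apply, Submodule.Quotient.mk_eq_zero]
    have : a • z = b • y := by
      apply f.injective
      rw [map_smul, map_smul, ← ha, ← hb, Algebra.smul_def, Algebra.smul_def]
      exact mul_comm _ _
    rw [this]
    exact A.smul_mem b hy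
  · rw [← LinearEquiv.map_eq_zero_iff f, ← ha]
    exact Ideal.Quotient.eq_zero_iff_mem.2 hap

/-- Iterating a chain above the image of an injective endomorphism. -/
theorem opow_succ_mem_chainOrdinals {φ : Module.End R M} (hφ : Function.Injective φ)
    {W : Submodule R M} (hW : LinearMap.range φ ≤ W) {e : Ordinal.{v}}
    (h : ω ^ e ∈ chainOrdinals R (M ⧸ W)) : ω ^ (e + 1) ∈ chainOrdinals R M := by
  obtain ⟨c, hc, hc0⟩ := h
  have hpos : ω ^ e ≠ 0 := (opow_pos e omega0_pos).ne'
  have hdiv (j : Set.Iio (ω ^ (e + 1) : Ordinal.{v})) : ∃ n : ℕ, j.1 / ω ^ e = n := by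
    rw [← lt_omega0, ← Ordinal.lt_mul_iff_div_lt hpos, ← Ordinal.opow_succ]
    exact j.2
  choose n hn using hdiv
  let r (j : Set.Iio (ω ^ (e + 1) : Ordinal.{v})) : Set.Iio (ω ^ e : Ordinal.{v}) :=
    ⟨j.1 % ω ^ e, mod_lt _ hpos⟩
  have hinj (m : ℕ) : Function.Injective (φ ^ m) := by
    rw [Module.End.coe_pow]
    exact hφ.iterate m
  -- Position `j = ω ^ e * n + r` receives the `φ ^ n`-image of the `r`-th member lifted from `M ⧸
  -- W`.
  refine ⟨fun j => ((c (r j)).comap W.mkQ).map (φ ^ n j), fun i j hij => ?_, fun j => ?_⟩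
  · have hij' : i.1 < j.1 := hij
    have hle : n i ≤ n j := by
      have h := Ordinal.div_le_left hij'.le (ω ^ e)
      rwa [hn, hn, Nat.cast_le] at h
    rcases hle.eq_or_lt with h | h
    · dsimp only
      rw [h]
      refine Submodule.map_strictMono_of_injective (hinj _)
        (Submodule.comap_strictMono_of_surjective W.mkQ_surjective (hc ?_))
      change i.1 % ω ^ e < j.1 % ω ^ e
      rw [← Ordinal.div_add_mod i.1 (ω ^ e), ← Ordinal.div_add_mod j.1 (ω ^ e), hn, hn, h,
        add_lt_add_iff_left] at hij'
      exact hij'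
    · refine lt_of_le_of_lt ?_ (Submodule.map_strictMono_of_injective (hinj (n i))
        (lt_comap_mkQ W (hc0 _)))
      -- Passing to a later block applies `φ` at least once more, which lands inside `φ ^ n i` of
      -- `W`, below the whole earlier block.
      obtain ⟨m, hm⟩ := Nat.exists_eq_add_of_lt h
      rintro _ ⟨x, -, rfl⟩
      refine ⟨φ ((φ ^ m) x), hW ⟨_, rfl⟩, ?_⟩
      rw [hm, add_assoc, pow_add, pow_succ']
      rfl
  · exact map_ne_bot (hinj _) (bot_le.trans_lt (lt_comap_mkQ W (hc0 _))).ne'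

end QuotientPrime

/-- Lower bound: for a prime `q` above `p` of dimension one less and `a ∈ q \ p`, multiplication by
`a` is injective with image in the kernel of `D → R ⧸ q`, so a chain for `q` can be repeated `ω`
times. Upper bound: proper quotients of `D` only involve primes strictly above `p`. Attainment is
carried along because the repetition needs an actual chain. -/
theorem length_quotientPrime [IsNoetherianRing R] (k : ℕ) (p : PrimeSpectrum R)
    (hk : Order.coheight p = k) (D : Type v) [AddCommGroup D] [Module R D]
    (f : D ≃ₗ[R] R ⧸ p.asIdeal) :
    ω ^ (k : Ordinal.{v}) ∈ chainOrdinals R D ∧ length R D = ω ^ (k : Ordinal.{v}) := by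
  induction k using Nat.strong_induction_on generalizing p D with
  | _ k IH =>
  have hfin : Module.Finite R D := Module.Finite.equiv f.symm
  have hnt : Nontrivial D := f.toEquiv.nontrivial
  have hmem : ω ^ (k : Ordinal.{v}) ∈ chainOrdinals R D := by
    cases k with
    | zero =>
      rw [Nat.cast_zero, opow_zero]
      exact one_mem_chainOrdinals
    | succ k =>
      obtain ⟨-, ⟨q, hpq, hq⟩, -⟩ := Order.coheight_eq_coe_add_one_iff.1 (by exact_mod_cast hk)
      obtain ⟨a, haq, hap⟩ := SetLike.exists_of_lt (show p.asIdeal < q.asIdeal from hpq)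
      have hle : p.asIdeal ≤ q.asIdeal := hpq.le
      let g : D →ₗ[R] R ⧸ q.asIdeal :=
        (Submodule.factor hle).comp f.toLinearMap
      have hg : Function.Surjective g := (Submodule.factor_surjective hle).comp f.surjective
      rw [Nat.cast_add, Nat.cast_one]
      refine opow_succ_mem_chainOrdinals (φ := LinearMap.lsmul R D a)
        ((injective_iff_map_eq_zero _).2 fun x hx => smul_eq_zero_of_quotientPrime f hap hx)
        (W := LinearMap.ker g) ?_
        (IH k k.lt_succ_self q hq _ (g.quotKerEquivOfSurjective hg)).1
      rintro _ ⟨x, rfl⟩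
      rw [LinearMap.mem_ker, LinearMap.lsmul_apply, map_smul, Algebra.smul_def]
      exact mul_eq_zero_of_left (Ideal.Quotient.eq_zero_iff_mem.2 haq) _
  refine ⟨hmem, (length_le ?_).antisymm (le_length hmem)⟩
  rintro γ ⟨c, hc, hc0⟩
  -- The chain before index `i` lives in the quotient by its `i`-th member, which is non-zero.
  refine le_of_forall_lt fun i hi => ?_
  refine (le_length (mem_chainOrdinals_quotient hc ⟨i, hi⟩)).trans_lt ?_
  refine length_lt_opow_of_lt_annihilator p.asIdeal (fun q hq D' _ _ f' => ?_) _
    (lt_annihilator_quotient f (hc0 _))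
  have hlt : Order.coheight q < k := Order.coheight_le_coe_iff.1 hk.le q hq
  obtain ⟨m, hm⟩ := ENat.ne_top_iff_exists.1 hlt.ne_top
  rw [← hm, Nat.cast_lt] at hlt
  rw [(IH m hlt q hm.symm D' f').2]
  exact (opow_lt_opow_iff_right one_lt_omega0).2 (Nat.cast_lt.2 hlt)

/-! ### Associated primes and the kernel of localization -/

theorem mem_assPoints_iff [IsNoetherianRing R] {p : PrimeSpectrum R} :
    p ∈ assPoints R M ↔ ∃ x : M, ∀ a : R, a • x = 0 ↔ a ∈ p.asIdeal := by
  change IsAssociatedPrime _ _ ↔ _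
  rw [isAssociatedPrime_iff]
  simp only [p.isPrime, true_and, SetLike.ext_iff, Submodule.mem_colon_singleton,
    Submodule.mem_bot]
  exact exists_congr fun x => forall_congr' fun a => Iff.comm

theorem assPoints_mono {N : Type v} [AddCommGroup N] [Module R N] {f : N →ₗ[R] M}
    (hf : Function.Injective f) : assPoints R N ⊆ assPoints R M :=
  fun _ hp => associatedPrimes.subset_of_injective hf hp

theorem subsingleton_of_assPoints_eq_empty [IsNoetherianRing R] (h : assPoints R M = ∅) :
    Subsingleton M := by
  by_contra hM
  rw [not_subsingleton_iff_nontrivial] at hM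
  obtain ⟨I, hI⟩ := associatedPrimes.nonempty R M
  have : (⟨I, hI.isPrime⟩ : PrimeSpectrum R) ∈ assPoints R M := hI
  rwa [h] at this

/-- `y` is supported, after localizing at `p`, only at the closed point. -/
def IsLocallyTorsion (p : PrimeSpectrum R) (y : M) : Prop :=
  ∀ a ∈ p.asIdeal, ∃ k : ℕ, ∃ t ∉ p.asIdeal, (t * a ^ k) • y = 0

/-- Otherwise some prime containing the annihilator of `y` avoids both `a` and the complement of
`p`; a minimal prime of the annihilator below it is associated to `M` and strictly inside `p`. -/
theorem isLocallyTorsion_of_minimal [IsNoetherianRing R] {p : PrimeSpectrum R}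
    (hp : ∀ q ∈ assPoints R M, ¬ q < p) (y : M) : IsLocallyTorsion p y := by
  intro a ha
  by_contra! h
  let I : Ideal R := (⊥ : Submodule R M).colon {y}
  have hI (r : R) : r ∈ I ↔ r • y = 0 := by
    rw [Submodule.mem_colon_singleton, Submodule.mem_bot]
  let S : Submonoid R := p.asIdeal.primeCompl ⊔ Submonoid.powers a
  have hdis : Disjoint (I : Set R) S := by
    rw [Set.disjoint_left]
    intro r hr hrS
    obtain ⟨t, ht, _, ⟨k, rfl⟩, rfl⟩ := Submonoid.mem_sup.1 hrS
    exact h k t ht ((hI _).1 hr)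
  obtain ⟨P, hP, hIP, hPS⟩ := Ideal.exists_le_prime_disjoint I S hdis
  obtain ⟨q, hq, hqP⟩ := Ideal.exists_minimalPrimes_le hIP
  obtain ⟨x, hx⟩ := Submodule.exists_eq_colon_of_mem_minimalPrimes hq
  refine hp ⟨q, hq.1.1⟩ (mem_assPoints_iff.2 ⟨x, fun r => ?_⟩) ?_
  · change _ ↔ r ∈ q
    rw [hx, Submodule.mem_colon_singleton, Submodule.mem_bot]
  · refine lt_of_le_of_ne (fun r hr => ?_) fun h => ?_
    · by_contra hrp
      exact Set.disjoint_left.1 hPS (hqP hr) (Submonoid.mem_sup_left (S := p.asIdeal.primeCompl) hrp)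
    · have haq : a ∈ q := by rwa [← h] at ha
      exact Set.disjoint_left.1 hPS (hqP haq)
        (Submonoid.mem_sup_right (Submonoid.mem_powers a))

variable (M) in
/-- The kernel of the localization of `M` at `p`. -/
def localKernel (p : PrimeSpectrum R) : Submodule R M where
  carrier := {y | ∃ s ∉ p.asIdeal, s • y = 0}
  zero_mem' := ⟨1, p.asIdeal.primeCompl.one_mem, smul_zero _⟩
  add_mem' := by
    rintro x y ⟨s, hs, hx⟩ ⟨t, ht, hy⟩
    refine ⟨s * t, p.asIdeal.primeCompl.mul_mem hs ht, ?_⟩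
    rw [smul_add, mul_comm, mul_smul, hx, mul_comm, mul_smul, hy, smul_zero, smul_zero, add_zero]
  smul_mem' := by
    rintro r x ⟨s, hs, hx⟩
    exact ⟨s, hs, by rw [smul_comm, hx, smul_zero]⟩

/-- An associated `q ≠ p` is not contained in `p`, so an element of `q` outside `p` kills the
witness for `q`. No element with annihilator `p` is killed from outside `p`. -/
theorem assPoints_localKernel [IsNoetherianRing R] {p : PrimeSpectrum R}
    (hp : ∀ q ∈ assPoints R M, ¬ q < p) :
    assPoints R (localKernel M p) = assPoints R M \ {p} := by
  ext q
  constructor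
  · intro hq
    refine ⟨assPoints_mono (localKernel M p).injective_subtype hq, ?_⟩
    rintro rfl
    obtain ⟨⟨x, s, hs, hsx⟩, hx⟩ := mem_assPoints_iff.1 hq
    exact hs ((hx s).1 (Subtype.ext hsx))
  · rintro ⟨hq, hqp⟩
    obtain ⟨x, hx⟩ := mem_assPoints_iff.1 hq
    have hle : ¬ q.asIdeal ≤ p.asIdeal := fun h => hp q hq (lt_of_le_of_ne h hqp)
    obtain ⟨s, hsq, hsp⟩ := SetLike.not_le_iff_exists.1 hle
    refine mem_assPoints_iff.2 ⟨⟨x, s, hsp, (hx s).2 hsq⟩, fun a => ?_⟩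
    rw [← hx a, Subtype.ext_iff]
    rfl

variable (R M) in
/-- For every associated prime `p`, the part of `M_p` supported at the closed point is simple. -/
def HasSimpleLocalTorsion : Prop :=
  ∀ (p : PrimeSpectrum R) (x y : M), (∀ a : R, a • x = 0 ↔ a ∈ p.asIdeal) →
    IsLocallyTorsion p y → ∃ s ∉ p.asIdeal, ∃ r : R, s • y = r • x

theorem HasSimpleLocalTorsion.submodule (h : HasSimpleLocalTorsion R M) (N : Submodule R M) :
    HasSimpleLocalTorsion R N := by
  intro p x y hx hy
  obtain ⟨s, hs, r, hr⟩ := h p (x : M) y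
    (fun a => by rw [← hx a, Subtype.ext_iff]; rfl)
    (fun a ha => by
      obtain ⟨k, t, ht, h⟩ := hy a ha
      exact ⟨k, t, ht, congrArg Subtype.val h⟩)
  exact ⟨s, hs, r, Subtype.ext hr⟩

/-- The dimension of the quotient by a prime ideal. -/
def primeDim (p : PrimeSpectrum R) : ℕ := (Order.coheight p).toNat

/-! ### Coefficients of the length as counts of associated primes -/

section Noetherian

variable [IsNoetherianRing R]

/-- `M ⧸ localKernel M p` and `R ⧸ p ≅ R x` embed into each other: `R x` meets the local kernel
trivially, and a common denominator multiplies `M` into `R x` with kernel exactly the local kernel.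
-/
theorem length_quotient_localKernel [Module.Finite R M] (h : HasSimpleLocalTorsion R M)
    {p : PrimeSpectrum R} (hdim : Order.coheight p ≠ ⊤) (hpM : p ∈ assPoints R M)
    (hp : ∀ q ∈ assPoints R M, ¬ q < p) :
    ω ^ (primeDim p : Ordinal.{v}) ∈ chainOrdinals R (M ⧸ localKernel M p) ∧
      length R (M ⧸ localKernel M p) = ω ^ (primeDim p : Ordinal.{v}) := by
  obtain ⟨x, hx⟩ := mem_assPoints_iff.1 hpM
  let j : R →ₗ[R] M := LinearMap.toSpanSingleton R M x
  have hker : LinearMap.ker j = p.asIdeal := Submodule.ext hx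
  obtain ⟨hD, hD'⟩ := length_quotientPrime (primeDim p) p (ENat.natCast_toNat hdim).symm
    (LinearMap.range j)
    (j.quotKerEquivRange.symm.trans (Submodule.quotEquivOfEq _ _ hker))
  have hinj : Function.Injective ((localKernel M p).mkQ.comp (LinearMap.range j).subtype) := by
    rw [injective_iff_map_eq_zero]
    rintro ⟨_, a, rfl⟩ ha
    rw [LinearMap.comp_apply, Submodule.mkQ_apply, Submodule.Quotient.mk_eq_zero] at ha
    obtain ⟨s, hs, hsx⟩ := ha
    have hsa : s * a ∈ p.asIdeal := by
      rw [← hx, mul_smul]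
      exact hsx
    exact Subtype.ext ((hx a).2 ((p.isPrime.mem_or_mem hsa).resolve_left hs))
  have hmem := chainOrdinals_mono hinj hD
  refine ⟨hmem, le_antisymm ?_ (le_length hmem)⟩
  have hrank (y : M) : ∃ s ∉ p.asIdeal, ∃ r : R, s • y = r • x :=
    h p x y hx (isLocallyTorsion_of_minimal hp y)
  choose s hs r hr using hrank
  obtain ⟨T, hT⟩ := Module.Finite.fg_top (R := R) (M := M)
  let g : M →ₗ[R] M := LinearMap.lsmul R M (∏ y ∈ T, s y)
  have hsT : ∏ y ∈ T, s y ∉ p.asIdeal :=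
    p.asIdeal.primeCompl.prod_mem fun y _ => hs y
  have hg : LinearMap.range g ≤ LinearMap.range j := by
    rw [LinearMap.range_eq_map, ← hT, Submodule.map_span_le]
    intro y hy
    classical
    refine ⟨(∏ z ∈ T.erase y, s z) * r y, ?_⟩
    change ((∏ z ∈ T.erase y, s z) * r y) • x = (∏ z ∈ T, s z) • y
    rw [mul_smul, ← hr, ← mul_smul, Finset.prod_erase_mul _ _ hy]
  have hgker : LinearMap.ker g = localKernel M p := by
    ext y
    refine ⟨fun hy => ⟨_, hsT, hy⟩, ?_⟩
    rintro ⟨t, ht, hty⟩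
    obtain ⟨a, ha⟩ := hg ⟨y, rfl⟩
    have h0 : t * a ∈ p.asIdeal := by
      rw [← hx, mul_smul]
      change t • j a = 0
      rw [ha, ← map_smul, hty, map_zero]
    have h1 := (hx a).2 ((p.isPrime.mem_or_mem h0).resolve_left ht)
    exact ha.symm.trans h1
  rw [← hD', ← length_congr (Submodule.quotEquivOfEq _ _ hgker),
    length_congr g.quotKerEquivRange]
  exact length_mono (f := Submodule.inclusion hg) (Submodule.inclusion_injective hg)

/-- The cohomological rank formula in the case of simple multiplicities: the coefficients of the
length count the associated primes by dimension. -/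
theorem coeff_length (hR : ∀ p : PrimeSpectrum R, Order.coheight p ≠ ⊤) [hfin : Module.Finite R M]
    (h : HasSimpleLocalTorsion R M) (e : Ordinal.{v}) :
    CNF.coeff ω (length R M) e =
      ((assPoints R M ∩ {p | (primeDim p : Ordinal.{v}) = e}).ncard : Ordinal.{v}) := by
  induction hn : (assPoints R M).ncard generalizing M e with
  | zero =>
    rw [Set.ncard_eq_zero (finite_assPoints R M)] at hn
    have := subsingleton_of_assPoints_eq_empty hn
    rw [length_eq_zero_of_subsingleton, hn]
    simp
  | succ n IH =>
    have hfinA := finite_assPoints R M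
    have hne : (assPoints R M).Nonempty := by
      rw [← Set.ncard_pos hfinA, hn]
      exact n.succ_pos
    -- Maximal dimension makes `p` minimal and also makes `ω ^ primeDim p` dominate every term of
    -- the remaining length.
    obtain ⟨p, hpM, hmax⟩ := Set.exists_max_image _ primeDim hfinA hne
    have hp (q) (hq : q ∈ assPoints R M) : ¬ q < p := by
      intro hlt
      refine (hmax q hq).not_gt ?_
      have := Order.coheight_strictAnti hlt (hR p).lt_top
      rwa [← ENat.natCast_toNat (hR p), ← ENat.natCast_toNat (hR q), Nat.cast_lt] at this
    have hass := assPoints_localKernel hp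
    have IH' := fun e => IH (M := localKernel M p) (h.submodule _) e (by
      rw [hass, Set.ncard_sdiff_singleton_of_mem hpM, hn, Nat.add_sub_cancel])
    rw [hass] at IH'
    obtain ⟨hmem, hlen⟩ := length_quotient_localKernel h (hR p) hpM hp
    have hsupp : ∀ e' ∈ (CNF.coeff ω (length R (localKernel M p))).support,
        e' ≤ (primeDim p : Ordinal.{v}) := by
      intro e' he'
      rw [Finsupp.mem_support_iff, IH'] at he'
      obtain ⟨q, hq, rfl⟩ : (assPoints R M \ {p} ∩ {p | (primeDim p : Ordinal.{v}) = e'}).Nonempty :=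
        Set.nonempty_of_ncard_ne_zero fun h => he' (by rw [h, Nat.cast_zero])
      exact Nat.cast_le.2 (hmax q hq.1)
    have hM : length R M = shuffleSum (ω ^ (primeDim p : Ordinal.{v}))
        (length R (localKernel M p)) := by
      refine le_antisymm ?_ ?_
      · rw [← hlen]
        exact length_le_shuffleSum _
      · rw [shuffleSum_omega0_opow hsupp]
        exact add_length_le _ hmem
    rw [hM, shuffleSum_comm, coeff_shuffleSum, Finsupp.add_apply, IH', coeff_omega0_opow]
    by_cases he : (primeDim p : Ordinal.{v}) = e
    · have hp' : p ∈ assPoints R M ∩ {p | (primeDim p : Ordinal.{v}) = e} := ⟨hpM, he⟩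
      rw [he, Finsupp.single_eq_same, ← Nat.cast_one, ← Nat.cast_add, Nat.cast_inj,
        ← Set.ncard_sdiff_singleton_add_one hp' (hfinA.inter_of_left _), Set.inter_sdiff_right_comm]
    · rw [Finsupp.single_eq_of_ne (Ne.symm he), add_zero, ← Set.inter_sdiff_right_comm,
        Set.sdiff_singleton_eq_self]
      exact fun h => he h.2

theorem valence_length (hR : ∀ p : PrimeSpectrum R, Order.coheight p ≠ ⊤) [Module.Finite R M]
    (h : HasSimpleLocalTorsion R M) : valence (length R M) = (assPoints R M).ncard := by
  classical
  have hfin := finite_assPoints R M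
  rw [Set.ncard_eq_toFinset_card _ hfin, valence, Finsupp.sum,
    Finset.card_eq_sum_card_fiberwise (f := fun p => (primeDim p : Ordinal.{v}))
      (t := (CNF.coeff ω (length R M)).support)]
  · refine Finset.sum_congr rfl fun e _ => ?_
    rw [coeff_length hR h, finiteValue, card_nat, Cardinal.toNat_natCast,
      Set.ncard_eq_toFinset_card _ (hfin.inter_of_left _)]
    congr 1
    ext p
    simp
  · intro p hp
    rw [Finset.mem_coe, Set.Finite.mem_toFinset] at hp
    rw [Finset.mem_coe, Finsupp.mem_support_iff, coeff_length hR h, Ne, Nat.cast_eq_zero,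
      Set.ncard_eq_zero (hfin.inter_of_left _)]
    exact Set.Nonempty.ne_empty ⟨p, hp, rfl⟩

/-! ### Nilpotent endomorphisms -/

/-- At a minimal associated prime a nilpotent map acts on a rank-one module, hence as zero; its
image falls into the local kernel, which has one associated prime fewer. -/
theorem pow_ncard_assPoints_eq_zero [hfin : Module.Finite R M] (h : HasSimpleLocalTorsion R M)
    {f : Module.End R M} (hf : IsNilpotent f) : f ^ (assPoints R M).ncard = 0 := by
  induction hn : (assPoints R M).ncard generalizing M with
  | zero =>
    rw [Set.ncard_eq_zero (finite_assPoints R M)] at hn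
    have := subsingleton_of_assPoints_eq_empty hn
    exact LinearMap.ext fun x => Subsingleton.elim _ _
  | succ n IH =>
    have hfinA := finite_assPoints R M
    have hne : (assPoints R M).Nonempty := by
      rw [← Set.ncard_pos hfinA, hn]
      exact n.succ_pos
    obtain ⟨p, hmin⟩ := hfinA.exists_minimal hne
    have hpM := hmin.prop
    have hp (q) (hq : q ∈ assPoints R M) : ¬ q < p := hmin.not_lt hq
    have hrank (x y) (hx : ∀ a : R, a • x = 0 ↔ a ∈ p.asIdeal) :=
      h p x y hx (isLocallyTorsion_of_minimal hp y)
    obtain ⟨x, hx⟩ := mem_assPoints_iff.1 hpM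
    have hfx : f x ∈ localKernel M p := by
      obtain ⟨s, hs, r, hr⟩ := hrank x (f x) hx
      obtain ⟨k, hk⟩ := hf
      -- `r / s` is the eigenvalue of `f` on `x` at `p`; nilpotence puts a power of `r` in `p`.
      have hpow (m : ℕ) : s ^ m • (f ^ m) x = r ^ m • x := by
        induction m with
        | zero => simp
        | succ m ih =>
          rw [pow_succ' f, Module.End.mul_apply, pow_succ', mul_smul, ← map_smul, ih, map_smul,
            smul_comm, hr, ← mul_smul, pow_succ]
      have hr0 := hpow k
      rw [hk, LinearMap.zero_apply, smul_zero] at hr0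
      have hrp := p.isPrime.mem_of_pow_mem _ ((hx _).1 hr0.symm)
      exact ⟨s, hs, hr.trans ((hx r).2 hrp)⟩
    have hrange (y : M) : f y ∈ localKernel M p := by
      obtain ⟨s, hs, r, hr⟩ := hrank x y hx
      obtain ⟨t, ht, htx⟩ := hfx
      refine ⟨t * s, p.asIdeal.primeCompl.mul_mem ht hs, ?_⟩
      rw [mul_smul, ← map_smul, hr, map_smul, smul_comm, htx, smul_zero]
    have hmaps : ∀ y ∈ localKernel M p, f y ∈ localKernel M p := fun y _ => hrange y
    have hres := IH (M := localKernel M p) (h.submodule _) (f := f.restrict hmaps)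
      (by
        obtain ⟨k, hk⟩ := hf
        refine ⟨k, LinearMap.ext fun y => Subtype.ext ?_⟩
        rw [Module.End.pow_restrict k hmaps, LinearMap.coe_restrict_apply, hk]
        rfl)
      (by rw [assPoints_localKernel hp, Set.ncard_sdiff_singleton_of_mem hpM, hn,
        Nat.add_sub_cancel])
    ext y
    have h0 := congrArg Subtype.val (LinearMap.congr_fun hres ⟨f y, hrange y⟩)
    rw [Module.End.pow_restrict n hmaps, LinearMap.coe_restrict_apply] at h0
    rw [pow_succ, Module.End.mul_apply]
    exact h0

end Noetherian

/-! ### Finite length and finitistic length -/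

theorem length_le_one_of_isSimpleModule [IsSimpleModule R M] : length R M ≤ 1 := by
  refine length_le ?_
  rintro α ⟨c, hc, hc0⟩
  by_contra! h
  have h1 : c ⟨0, one_pos.trans h⟩ = ⊤ := (eq_bot_or_eq_top _).resolve_left (hc0 _)
  have h2 : c ⟨1, h⟩ = ⊤ := (eq_bot_or_eq_top _).resolve_left (hc0 _)
  refine (hc (show (⟨0, one_pos.trans h⟩ : Set.Iio α) < ⟨1, h⟩ from ?_)).ne (h2.trans h1.symm)
  exact zero_lt_one' Ordinal

theorem length_lt_omega0_of_isFiniteLength (h : IsFiniteLength R M) : length R M < ω := by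
  induction h with
  | of_subsingleton =>
    rw [length_eq_zero_of_subsingleton]
    exact omega0_pos
  | @of_simple_quotient M _ _ N _ hN ih =>
    have hM := IsFiniteLength.of_simple_quotient hN
    have := (isFiniteLength_iff_isNoetherian_isArtinian.1 hM).1
    refine (length_le_shuffleSum N).trans_lt ?_
    rw [← opow_one ω] at ih ⊢
    refine shuffleSum_lt_opow (length_le_one_of_isSimpleModule.trans_lt ?_) ih
    rw [opow_one]
    exact one_lt_omega0

theorem isArtinian_of_length_lt_omega0 (h : length R M < ω) : IsArtinian R M := by
  rw [isArtinian_iff, RelEmbedding.wellFounded_iff_isEmpty]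
  refine ⟨fun g => h.not_ge (le_length ?_)⟩
  have hg {m n : ℕ} (hmn : m < n) : g n < g m := g.map_rel_iff.2 hmn
  choose n hn using fun i : Set.Iio (ω : Ordinal.{v}) => lt_omega0.1 i.2
  refine ⟨fun i => g (n i), fun i j hij => hg ?_, fun i =>
    (bot_le.trans_lt (hg (n i).lt_succ_self)).ne'⟩
  have hij' : i.1 < j.1 := hij
  rwa [hn, hn, Nat.cast_lt] at hij'

theorem length_lt_omega0_iff [IsNoetherian R M] : length R M < ω ↔ IsArtinian R M :=
  ⟨isArtinian_of_length_lt_omega0, fun h => length_lt_omega0_of_isFiniteLength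
    (isFiniteLength_iff_isNoetherian_isArtinian.2 ⟨inferInstance, h⟩)⟩

/-- The sum of two Artinian submodules is Artinian, so a maximal one contains all others. -/
theorem exists_finitisticLength_bound [IsNoetherian R M] :
    ∃ X : Submodule R M, length R X < ω ∧
      ∀ N : Submodule R M, length R N < ω → length R N ≤ length R X := by
  obtain ⟨X, hX⟩ := exists_maximal_of_wellFoundedGT
    (fun N : Submodule R M => IsArtinian R N) ⟨⊥, inferInstance⟩
  refine ⟨X, length_lt_omega0_iff.2 hX.prop, fun N hN => ?_⟩
  have := hX.prop
  have := isArtinian_of_length_lt_omega0 hN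
  have hle : N ≤ X := le_sup_left.trans (hX.le_of_ge (y := N ⊔ X) inferInstance le_sup_right)
  exact length_mono (Submodule.inclusion_injective hle)

theorem finitisticLength_lt_omega0 [IsNoetherian R M] : finitisticLength R M < ω := by
  obtain ⟨X, hX, h⟩ := exists_finitisticLength_bound (R := R) (M := M)
  refine lt_of_le_of_lt (csSup_le ⟨_, X, rfl, hX⟩ ?_) hX
  rintro _ ⟨N, rfl, hN⟩
  exact h N hN

theorem length_le_finitisticLength [IsNoetherian R M] (N : Submodule R M) [IsArtinian R N] :
    length R N ≤ finitisticLength R M := by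
  obtain ⟨X, hX, h⟩ := exists_finitisticLength_bound (R := R) (M := M)
  refine le_csSup ⟨length R X, ?_⟩ ⟨N, rfl, length_lt_omega0_iff.2 inferInstance⟩
  rintro _ ⟨N, rfl, hN⟩
  exact h N hN

/-- If `y ∉ R x`, then `R x + R y ⊋ R x ⊋ 0` is a two-step chain inside an Artinian submodule. -/
theorem mem_span_singleton_of_finitisticLength_le_one [IsNoetherian R M]
    (h : finiteValue (finitisticLength R M) ≤ 1) {x y : M} (hx : x ≠ 0)
    [IsArtinian R (Submodule.span R {x})] [IsArtinian R (Submodule.span R {y})] :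
    y ∈ Submodule.span R {x} := by
  by_contra hy
  -- `finiteValue` is `0` on infinite ordinals, so finiteness must be known first.
  have h1 : finitisticLength R M ≤ 1 := by
    obtain ⟨n, hn⟩ := lt_omega0.1 (finitisticLength_lt_omega0 (R := R) (M := M))
    rw [hn, finiteValue, card_nat, Cardinal.toNat_natCast] at h
    rw [hn]
    exact_mod_cast h
  let T := Submodule.span R {x} ⊔ Submodule.span R {y}
  let X : Submodule R T := (Submodule.span R {x}).comap T.subtype
  have hxT : x ∈ T := Submodule.mem_sup_left (Submodule.mem_span_singleton_self x)
  have hyT : y ∈ T := Submodule.mem_sup_right (Submodule.mem_span_singleton_self y)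
  have : Nontrivial X := by
    refine nontrivial_of_ne ⟨⟨x, hxT⟩, Submodule.mem_span_singleton_self x⟩ 0 fun h => hx ?_
    exact congrArg (fun z : X => (z : M)) h
  have : Nontrivial (T ⧸ X) := by
    refine Submodule.Quotient.nontrivial_iff.2 fun h => hy ?_
    have : (⟨y, hyT⟩ : T) ∈ X := h ▸ Submodule.mem_top
    exact this
  have h2 := le_length (add_mem_chainOrdinals (R := R) X one_mem_chainOrdinals
    one_mem_chainOrdinals)
  have h3 := h2.trans ((length_le_finitisticLength T).trans h1)
  rw [one_add_one_eq_two] at h3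
  exact h3.not_gt one_lt_two

/-- The maximal ideal is the only prime containing the annihilator of `y`, so `R y` is a quotient
ring of dimension zero. -/
theorem isArtinian_span_singleton [IsNoetherianRing R] [IsLocalRing R] {y : M}
    (h : ∀ a ∈ IsLocalRing.maximalIdeal R, ∃ k : ℕ, a ^ k • y = 0) :
    IsArtinian R (Submodule.span R {y}) := by
  let I : Ideal R := LinearMap.ker (LinearMap.toSpanSingleton R M y)
  have hprime (P : Ideal R) (hP : P.IsPrime) (hIP : I ≤ P) : P = IsLocalRing.maximalIdeal R := by
    refine le_antisymm (IsLocalRing.le_maximalIdeal hP.ne_top) fun a ha => ?_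
    obtain ⟨k, hk⟩ := h a ha
    exact hP.mem_of_pow_mem k (hIP hk)
  have hdim : Ring.KrullDimLE 0 (R ⧸ I) := by
    rw [Ring.krullDimLE_zero_iff]
    intro P hP
    have hc := hprime (P.comap (Ideal.Quotient.mk I)) (hP.comap _)
      (by
        intro a ha
        rw [Ideal.mem_comap, Ideal.Quotient.eq_zero_iff_mem.2 ha]
        exact P.zero_mem)
    rw [← Ideal.map_comap_of_surjective _ Ideal.Quotient.mk_surjective P] at hP ⊢
    have hmax := hc ▸ IsLocalRing.maximalIdeal.isMaximal R
    exact (Ideal.map_eq_top_or_isMaximal_of_surjective _ Ideal.Quotient.mk_surjective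
      hmax).resolve_left hP.ne_top
  have hart : IsArtinianRing (R ⧸ I) :=
    isArtinianRing_iff_isNoetherianRing_krullDimLE_zero.2 ⟨inferInstance, hdim⟩
  have : IsArtinian R (R ⧸ I) :=
    isArtinian_of_surjective_algebraMap (R := R ⧸ I) (Ideal.Quotient.mk_surjective)
  have := (LinearMap.toSpanSingleton R M y).quotKerEquivRange.isArtinian_iff.1 this
  rwa [LinearMap.range_toSpanSingleton] at this

theorem multiplicity_le_one [IsNoetherianRing R] [Module.Finite R M] (hM : IsBinary R M)
    {p : PrimeSpectrum R} (hp : p ∈ assPoints R M) : multiplicity R M p ≤ 1 := by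
  classical
  obtain ⟨S, hS⟩ := hM
  have h := DFunLike.congr_fun hS p
  rw [fundamentalCycle, finsum_mem_eq_finite_toFinset_sum _ (finite_assPoints R M),
    Finsupp.finsetSum_apply, Finsupp.finsetSum_apply] at h
  simp only [Finsupp.single_apply, Finset.sum_ite_eq', Set.Finite.mem_toFinset, hp, if_true] at h
  split_ifs at h <;> omega

/-- The images of `x` and `y` in `M_p` generate Artinian submodules. Multiplicity at most one puts
the image of `y` in the span of that of `x`; clearing denominators gives the relation in `M`. -/
theorem IsBinary.hasSimpleLocalTorsion [IsNoetherianRing R] [Module.Finite R M]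
    (hM : IsBinary R M) : HasSimpleLocalTorsion R M := by
  intro p x y hx hy
  let S := p.asIdeal.primeCompl
  let A := Localization.AtPrime p.asIdeal
  let j := LocalizedModule.mkLinearMap S M
  have hxt : IsLocallyTorsion p x := fun a ha => ⟨1, 1, S.one_mem, by
    rw [one_mul, pow_one, (hx a).2 ha]⟩
  have hart {z : M} (hz : IsLocallyTorsion p z) : IsArtinian A (Submodule.span A {j z}) := by
    refine isArtinian_span_singleton fun α hα => ?_
    obtain ⟨a, s, rfl⟩ := IsLocalization.exists_mk'_eq S α
    have ha : a ∈ p.asIdeal := by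
      rwa [IsLocalization.AtPrime.mk'_mem_maximal_iff A p.asIdeal] at hα
    obtain ⟨k, t, ht, h⟩ := hz a ha
    refine ⟨k, ?_⟩
    have h0 : j (a ^ k • z) = 0 :=
      (IsLocalizedModule.eq_zero_iff S j).2 ⟨⟨t, ht⟩, (mul_smul t (a ^ k) z).symm.trans h⟩
    rw [IsLocalization.mk'_eq_mul_mk'_one, mul_pow, mul_comm, mul_smul, ← map_pow,
      algebraMap_smul, ← map_smul, h0, smul_zero]
  have := hart hxt
  have := hart hy
  have hx0 : j x ≠ 0 := by
    intro h
    obtain ⟨s, hs⟩ := (IsLocalizedModule.eq_zero_iff S j).1 h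
    exact s.2 ((hx s).1 hs)
  have hmult := multiplicity_le_one hM (mem_assPoints_iff.2 ⟨x, hx⟩)
  have hmem : j y ∈ Submodule.span A {j x} :=
    mem_span_singleton_of_finitisticLength_le_one hmult hx0
  obtain ⟨β, hβ⟩ := Submodule.mem_span_singleton.1 hmem
  obtain ⟨r, s, rfl⟩ := IsLocalization.exists_mk'_eq S β
  have hsr : j (s • y) = j (r • x) := by
    rw [Submonoid.smul_def, map_smul, ← hβ, ← algebraMap_smul A, ← mul_smul, mul_comm,
      IsLocalization.mk'_spec, algebraMap_smul, map_smul]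
  obtain ⟨c, hc⟩ := (IsLocalizedModule.eq_iff_exists S j).1 hsr
  refine ⟨c * s, S.mul_mem c.2 s.2, c * r, ?_⟩
  rw [mul_smul, mul_smul]
  exact hc

theorem assPoints_ker_union_range [IsNoetherianRing R] (g : Module.End R M) :
    assPoints R M = assPoints R (LinearMap.ker g) ∪ assPoints R (LinearMap.range g) := by
  refine Set.Subset.antisymm (fun p hp => ?_) (Set.union_subset
    (assPoints_mono (LinearMap.ker g).injective_subtype)
    (assPoints_mono (LinearMap.range g).injective_subtype))
  refine associatedPrimes.subset_union_of_exact (f := (LinearMap.ker g).subtype)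
    (g := g.rangeRestrict) (LinearMap.ker g).injective_subtype ?_ hp
  rw [LinearMap.exact_iff, LinearMap.ker_rangeRestrict, Submodule.range_subtype]

/-- A common prime would give witnesses `x ∈ K`, `y ∈ I` with a non-zero common multiple `s • y = r
• x` in `K ⊓ I`. -/
theorem HasSimpleLocalTorsion.disjoint_assPoints [IsNoetherianRing R]
    (h : HasSimpleLocalTorsion R M) {K I : Submodule R M} (hKI : K ⊓ I = ⊥) :
    Disjoint (assPoints R K) (assPoints R I) := by
  rw [Set.disjoint_left]
  intro p hK hI
  obtain ⟨x, hx⟩ := mem_assPoints_iff.1 hK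
  obtain ⟨y, hy⟩ := mem_assPoints_iff.1 hI
  obtain ⟨s, hs, r, hsr⟩ := h p (x : M) y (fun a => by rw [← hx a, Subtype.ext_iff]; rfl)
    fun a ha => ⟨1, 1, p.asIdeal.primeCompl.one_mem, by
      rw [one_mul, pow_one]; exact congrArg Subtype.val ((hy a).2 ha)⟩
  have h0 : s • (y : M) ∈ K ⊓ I := ⟨hsr ▸ K.smul_mem r x.2, I.smul_mem s y.2⟩
  rw [hKI, Submodule.mem_bot] at h0
  exact hs ((hy s).1 (Subtype.ext h0))

end Modules

end OrdLen

end

theorem corollaryC {R : Type u} [CommRing R] [IsNoetherianRing R] (hR : ringKrullDim R ≠ ⊤)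
    {M : Type v} [AddCommGroup M] [Module R M] [Module.Finite R M]
    (hM : OrdLen.IsBinary R M) (n : ℕ) (hn : OrdLen.valence (OrdLen.length R M) = n)
    (f : Module.End R M) :
    LinearMap.ker (f ^ n) = LinearMap.ker (f ^ (n + 1)) ∧
      OrdLen.IsReductive (f ^ n) ∧ OrdLen.RankNullity (f ^ n) := by
  have hdim (p : PrimeSpectrum R) : Order.coheight p ≠ ⊤ := by
    intro h
    have h' := Order.coheight_le_krullDim p
    rw [h] at h'
    exact hR (top_le_iff.1 h')
  have h := hM.hasSimpleLocalTorsion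
  rw [OrdLen.valence_length hdim h] at hn
  -- The bound does not depend on `m`: `f` is nilpotent on `ker (f ^ m)`, whose associated primes
  -- are among the `n` of `M`.
  have hker (m : ℕ) : LinearMap.ker (f ^ m) ≤ LinearMap.ker (f ^ n) := by
    have hmaps : ∀ x ∈ LinearMap.ker (f ^ m), f x ∈ LinearMap.ker (f ^ m) := by
      intro x hx
      rw [LinearMap.mem_ker] at hx ⊢
      rw [← Module.End.mul_apply, ← pow_succ, pow_succ', Module.End.mul_apply, hx, map_zero]
    have hnil : IsNilpotent (f.restrict hmaps) := ⟨m, LinearMap.ext fun x => Subtype.ext (by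
      rw [Module.End.pow_restrict m hmaps, LinearMap.coe_restrict_apply]; exact x.2)⟩
    have h0 := OrdLen.pow_ncard_assPoints_eq_zero (h.submodule _) hnil
    have hle : (OrdLen.assPoints R (LinearMap.ker (f ^ m))).ncard ≤ n := hn ▸ Set.ncard_le_ncard
      (OrdLen.assPoints_mono (LinearMap.ker (f ^ m)).injective_subtype)
      (OrdLen.finite_assPoints R M)
    intro x hx
    have h1 := congrArg Subtype.val (LinearMap.congr_fun (pow_eq_zero_of_le hle h0) ⟨x, hx⟩)
    rwa [Module.End.pow_restrict n hmaps, LinearMap.coe_restrict_apply] at h1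
  have hred : OrdLen.IsReductive (f ^ n) := by
    rw [OrdLen.IsReductive, eq_bot_iff]
    rintro _ ⟨hx, y, rfl⟩
    -- An element `f ^ n y` of the kernel has `y ∈ ker (f ^ (n + n))`, so it is zero already.
    refine hker (n + n) ?_
    rw [LinearMap.mem_ker, pow_add, Module.End.mul_apply]
    exact hx
  refine ⟨le_antisymm (fun x hx => ?_) (hker (n + 1)), hred, ?_⟩
  · rw [LinearMap.mem_ker] at hx ⊢
    rw [pow_succ', Module.End.mul_apply, hx, map_zero]
  · refine Ordinal.CNF.coeff_injective Ordinal.omega0 (Finsupp.ext fun e => ?_)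
    rw [OrdLen.coeff_shuffleSum, Finsupp.add_apply, OrdLen.coeff_length hdim h,
      OrdLen.coeff_length hdim (h.submodule _), OrdLen.coeff_length hdim (h.submodule _),
      ← Nat.cast_add, ← Set.ncard_union_eq ((h.disjoint_assPoints hred).mono
        Set.inter_subset_left Set.inter_subset_left)
      ((OrdLen.finite_assPoints R _).inter_of_left _)
      ((OrdLen.finite_assPoints R _).inter_of_left _), ← Set.union_inter_distrib_right,
      ← OrdLen.assPoints_ker_union_range]
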